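/- Let $\phi:\mathcal X\to\mathbb R^d$ be a representation, $\mathcal D=(x_1,\dots,x_N)$ a finite dataset in $\mathcal X$ with $\|\phi(x_n)\|_2\le 1$ for all $n$, $\sigma:\mathbb R\to[-1,1]$ an odd function, $\theta\in\mathbb R^d$ with $\theta\neq 0$, and let $\tau_\theta(x)=\sigma(\theta^T\phi(x))$. For $w\in\mathbb R^d$ put $\mathcal L_\theta(w)=\sum_{n=1}^N\exp(-\tau_\theta(x_n)\,w^T\phi(x_n))$. Given $w_0\in\mathbb R^d$ and $\eta>0$, let $w_{m+1}=w_m-\eta\nabla\mathcal L_\theta(w_m)$ be the gradient descent iterates, and let $\mathcal L_M^{\mathrm{binary}}(\theta)=\mathcal L_\theta(w_M)$. Call the labeling $\tau_\theta$ linearly separable if some $w\in\mathbb R^d$ satisfies $\tau_\theta(x_n)\,w^T\phi(x_n)>0$ for all $n$. (a) If $\sigma(t)>0$ for all $t>0$ (e.g. $\sigma=\tanh$) and $\theta^T\phi(x_n)\ne 0$ for all $n$, then $\tau_\theta$ is linearly separable. (b) Suppose $\tau_\theta$ is linearly separable. Then the hard-margin SVM problem $$\min_{w}\ \|w\|_2^2\quad\text{s.t.}\quad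 \tau_\theta(x_n)\,w^T\phi(x_n)\ge 1\ \ \text{for all } n$$ has a unique solution $w_{\mathrm{SVM}}(\theta)$. Let $S_\theta=\{n:\tau_\theta(x_n)\,w_{\mathrm{SVM}}(\theta)^T\phi(x_n)=1\}$. Suppose moreover that the dataset is non-degenerate: the vectors $\phi(x_n)$, $n\in S_\theta$, span the same subspace as all the $\phi(x_n)$, and the dual problem $$\max_{\alpha\ge 0}\ \sum_n\alpha_n-\tfrac12\sum_{i,j}\alpha_i\alpha_j\tau_\theta(x_i)\tau_\theta(x_j)\,\phi(x_i)^T\phi(x_j)$$ has a solution with $\alpha_n>0$ for $n\in S_\theta$ and $\alpha_n=0$ for $n\notin S_\theta$. Then for every $w_0\in\mathbb R^d$ and every step size $0<\eta<1/\mathcal L_\theta(w_0)$ there are a dual solution $\alpha$ and a vector $\tilde w(\theta)\in\mathbb R^d$ with $\eta\exp(-\tau_\theta(x_n)\,\tilde w(\theta)^T\phi(x_n))=\alpha_n$ for all $n\in S_\theta$, such that the residuals $r_M(\theta)$ defined by $$w_M=w_{\mathrm{SVM}}(\theta)\log M+\tilde w(\theta)+r_M(\theta)\qquad(M\ge1)$$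 are bounded, $\lim_{M\to\infty}\|r_M(\theta)\|_2=0$, and for every $M\ge 1$ $$\mathcal L_M^{\mathrm{binary}}(\theta)\ \ge\ \bigl(M\eta\exp(\|r_M(\theta)\|_2)\bigr)^{-1}\,\|w_{\mathrm{SVM}}(\theta)\|_2^2 .$$ -/

import Mathlib

noncomputable section

namespace GenObjective

variable {X : Type*} {d N : ℕ}

/-- The linear task encoder `τ_θ(x) = σ(θᵀ φ(x))`. -/
def taskEncoder (σ : ℝ → ℝ) (φ : X → EuclideanSpace ℝ (Fin d))
    (θ : EuclideanSpace ℝ (Fin d)) (a : X) : ℝ :=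
  σ (inner ℝ θ (φ a))

/-- The exponential loss on the dataset `x₁, …, x_N` of the linear model `wᵀ φ(·)` with respect
to the labeling `τ`. -/
def expLoss (φ : X → EuclideanSpace ℝ (Fin d)) (x : Fin N → X) (τ : X → ℝ)
    (w : EuclideanSpace ℝ (Fin d)) : ℝ :=
  ∑ n, Real.exp (-(τ (x n) * inner ℝ w (φ (x n))))

/-- One step of gradient descent on the exponential loss with step size `η`. -/
def gdStep (φ : X → EuclideanSpace ℝ (Fin d)) (x : Fin N → X) (τ : X → ℝ) (η : ℝ)
    (w : EuclideanSpace ℝ (Fin d)) : EuclideanSpace ℝ (Fin d) :=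
  w - η • gradient (expLoss φ x τ) w

/-- The iterate `w_M` after `M` steps of gradient descent started at `w₀`. -/
def gdIterate (φ : X → EuclideanSpace ℝ (Fin d)) (x : Fin N → X) (τ : X → ℝ) (η : ℝ)
    (w₀ : EuclideanSpace ℝ (Fin d)) (M : ℕ) : EuclideanSpace ℝ (Fin d) :=
  (gdStep φ x τ η)^[M] w₀

/-- The generalization-based objective `L_M^binary(θ)`: the exponential loss, with respect to the
labeling `τ_θ`, of the linear model trained by `M` gradient descent steps on that labeling. -/
def binaryObjective (φ : X → EuclideanSpace ℝ (Fin d)) (x : Fin N → X) (σ : ℝ → ℝ) (η : ℝ)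
    (w₀ : EuclideanSpace ℝ (Fin d)) (M : ℕ) (θ : EuclideanSpace ℝ (Fin d)) : ℝ :=
  expLoss φ x (taskEncoder σ φ θ) (gdIterate φ x (taskEncoder σ φ θ) η w₀ M)

/-- Some linear model without bias has a positive margin on every data point. -/
def LinearlySeparable (φ : X → EuclideanSpace ℝ (Fin d)) (x : Fin N → X) (τ : X → ℝ) : Prop :=
  ∃ w : EuclideanSpace ℝ (Fin d), ∀ n, 0 < τ (x n) * inner ℝ w (φ (x n))

/-- The feasible set of the hard-margin SVM. -/
def svmFeasible (φ : X → EuclideanSpace ℝ (Fin d)) (x : Fin N → X) (τ : X → ℝ) :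
    Set (EuclideanSpace ℝ (Fin d)) :=
  {w | ∀ n, 1 ≤ τ (x n) * inner ℝ w (φ (x n))}

/-- `w` solves the (primal) hard-margin SVM problem. -/
def IsHardMarginSVM (φ : X → EuclideanSpace ℝ (Fin d)) (x : Fin N → X) (τ : X → ℝ)
    (w : EuclideanSpace ℝ (Fin d)) : Prop :=
  w ∈ svmFeasible φ x τ ∧ IsMinOn (fun v => ‖v‖ ^ 2) (svmFeasible φ x τ) w

/-- The hard-margin SVM solution `w_SVM` (meaningful when the problem has a solution). -/
def wSVM (φ : X → EuclideanSpace ℝ (Fin d)) (x : Fin N → X) (τ : X → ℝ) :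
    EuclideanSpace ℝ (Fin d) :=
  Classical.epsilon (IsHardMarginSVM φ x τ)

/-- The objective of the dual hard-margin SVM problem. -/
def svmDualObjective (φ : X → EuclideanSpace ℝ (Fin d)) (x : Fin N → X) (τ : X → ℝ)
    (α : Fin N → ℝ) : ℝ :=
  ∑ n, α n -
    (1 / 2) * ∑ i, ∑ j, α i * α j * τ (x i) * τ (x j) * inner ℝ (φ (x i)) (φ (x j))

/-- `α` solves the dual hard-margin SVM problem. -/
def IsDualSVM (φ : X → EuclideanSpace ℝ (Fin d)) (x : Fin N → X) (τ : X → ℝ)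
    (α : Fin N → ℝ) : Prop :=
  (∀ n, 0 ≤ α n) ∧ IsMaxOn (svmDualObjective φ x τ) {β | ∀ n, 0 ≤ β n} α

/-- The indices of the support vectors. -/
def supportIdx (φ : X → EuclideanSpace ℝ (Fin d)) (x : Fin N → X) (τ : X → ℝ) : Set (Fin N) :=
  {n | τ (x n) * inner ℝ (wSVM φ x τ) (φ (x n)) = 1}

/-- The dataset is non-degenerate for the labeling `τ`: the support vectors span the data, and
some dual solution is strictly positive exactly at the support vectors. -/
def NonDegenerate (φ : X → EuclideanSpace ℝ (Fin d)) (x : Fin N → X) (τ : X → ℝ) : Prop :=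
  Submodule.span ℝ ((fun n => φ (x n)) '' supportIdx φ x τ) =
      Submodule.span ℝ (Set.range fun n => φ (x n)) ∧
    ∃ α : Fin N → ℝ, IsDualSVM φ x τ α ∧
      (∀ n ∈ supportIdx φ x τ, 0 < α n) ∧ ∀ n ∉ supportIdx φ x τ, α n = 0

end GenObjective

end

/-! With `z n = τ(x_n) φ(x_n)`, a gradient step adds `η ∑ exp(-⟪w, z n⟫) z n`. Write `ŵ` for the SVM
solution. Along `ŵ log M + w̃` a support vector has weight `exp(-⟪w̃, z n⟫) / M`, so to leading
order the step is `(∑_S α_n z_n) / M` with `α_n = η exp(-⟪w̃, z n⟫)`. This matches the increment of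
`ŵ log M` exactly when `∑_S α_n z_n = ŵ`. Such a `w̃` exists in `w₀ + span` as a minimizer of a
potential made coercive by the strictly positive dual weights (`exists_sum_exp_smul_eq`).
Complementary slackness makes the new `α` dual optimal.

The residual `r` stays in the span of the support vectors, and `‖r‖²` drops by at least `D(r) / M`,
where `D(r) = ∑_S α_n (1 - e^{-t_n}) t_n`, `t_n = ⟪r, z n⟫`, up to summable errors
(`residual_step`): the discretization of `log`, the non-support vectors with margin above 1, and the
squared steps, summable by the descent lemma. By `robbins_siegmund`, `‖r‖` converges and `∑ D(r_M) /
M` is finite. A nonzero limit would keep `D` away from zero and contradict divergence of the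
harmonic series.

For the loss bound, each support term is at least `exp(-‖r‖) α_n / (M η)`, and `∑ α_n = ‖ŵ‖²`. -/

namespace GenObjective

open Filter Topology
open scoped RealInnerProductSpace

/-- A deterministic Robbins–Siegmund lemma. -/
theorem robbins_siegmund {a c s : ℕ → ℝ} (ha : ∀ m, 0 ≤ a m) (hc : ∀ m, 0 ≤ c m)
    (hs : ∀ m, 0 ≤ s m) (hcs : Summable c)
    (h : ∀ m, a (m + 1) ≤ a m + c m * (1 + a m) - s m) :
    (∃ l, Tendsto a atTop (𝓝 l)) ∧ Summable s := by
  -- Discrete Grönwall; the resulting uniform bound turns the multiplicative error `c m * (1 + a m)`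
  -- into the summable `B * c m`.
  have hbound : ∀ m, 1 + a m ≤ (1 + a 0) * Real.exp (∑ k ∈ Finset.range m, c k) := by
    intro m
    induction m with
    | zero => simp
    | succ m ih =>
      rw [Finset.sum_range_succ, Real.exp_add, ← mul_assoc]
      calc 1 + a (m + 1) ≤ (1 + a m) * (c m + 1) := by nlinarith [h m, hs m]
        _ ≤ (1 + a m) * Real.exp (c m) := by
          have := ha m
          gcongr
          exact Real.add_one_le_exp _
        _ ≤ _ := by gcongr
  obtain ⟨B, hB⟩ : ∃ B, ∀ m, 1 + a m ≤ B := by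
    refine ⟨(1 + a 0) * Real.exp (∑' k, c k), fun m => (hbound m).trans ?_⟩
    have := ha 0
    gcongr
    exact hcs.sum_le_tsum _ fun i _ => hc i
  have hstep : ∀ m, a (m + 1) ≤ a m + B * c m - s m := fun m => by
    nlinarith [h m, mul_le_mul_of_nonneg_left (hB m) (hc m)]
  have hcB : Summable fun m => B * c m := hcs.mul_left B
  have hB0 : 0 ≤ B := by linarith [hB 0, ha 0]
  have hle : ∀ m, ∑ k ∈ Finset.range m, B * c k ≤ ∑' k, B * c k := fun m =>
    hcB.sum_le_tsum _ fun i _ => mul_nonneg hB0 (hc i)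
  constructor
  · have hanti : Antitone fun m => a m - ∑ k ∈ Finset.range m, B * c k := by
      refine antitone_nat_of_succ_le fun m => ?_
      rw [Finset.sum_range_succ]
      linarith [hstep m, hs m]
    have hbdd : BddBelow (Set.range fun m => a m - ∑ k ∈ Finset.range m, B * c k) := by
      refine ⟨-∑' k, B * c k, ?_⟩
      rintro _ ⟨m, rfl⟩
      dsimp only
      linarith [ha m, hle m]
    have := (tendsto_atTop_ciInf hanti hbdd).add hcB.hasSum.tendsto_sum_nat
    simp only [sub_add_cancel] at this
    exact ⟨_, this⟩
  · refine summable_of_sum_range_le (c := a 0 + ∑' k, B * c k) hs fun m => ?_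
    have : a m + ∑ k ∈ Finset.range m, s k ≤ a 0 + ∑ k ∈ Finset.range m, B * c k := by
      induction m with
      | zero => simp
      | succ m ih =>
        rw [Finset.sum_range_succ, Finset.sum_range_succ]
        linarith [hstep m]
    linarith [ha m, hle m]

/-! ### Descent lemma and square-summable steps -/

section Descent

variable {E ι : Type*} [NormedAddCommGroup E] [InnerProductSpace ℝ E] [Fintype ι] {z : ι → E}

theorem norm_sum_exp_smul_le (hz : ∀ n, ‖z n‖ ≤ 1) (v : E) :
    ‖∑ n, Real.exp (-⟪v, z n⟫) • z n‖ ≤ ∑ n, Real.exp (-⟪v, z n⟫) := by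
  refine (norm_sum_le _ _).trans (Finset.sum_le_sum fun n _ => ?_)
  rw [norm_smul, Real.norm_of_nonneg (Real.exp_pos _).le]
  exact mul_le_of_le_one_right (Real.exp_pos _).le (hz n)

/-- The descent lemma for one gradient step on the exponential loss. -/
theorem expLoss_descent (hz : ∀ n, ‖z n‖ ≤ 1) {η : ℝ} (hη : 0 < η) (v : E)
    (hηv : η * ∑ n, Real.exp (-⟪v, z n⟫) ≤ 1) :
    ∑ n, Real.exp (-⟪v + η • ∑ k, Real.exp (-⟪v, z k⟫) • z k, z n⟫) ≤
      ∑ n, Real.exp (-⟪v, z n⟫) - η * (1 - η * ∑ n, Real.exp (-⟪v, z n⟫)) *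
        ‖∑ k, Real.exp (-⟪v, z k⟫) • z k‖ ^ 2 := by
  set g := ∑ k, Real.exp (-⟪v, z k⟫) • z k with hg
  set L := ∑ n, Real.exp (-⟪v, z n⟫) with hL
  have hgL : ‖g‖ ≤ L := norm_sum_exp_smul_le hz v
  have hgz : ∀ n, |⟪g, z n⟫| ≤ ‖g‖ := fun n =>
    (abs_real_inner_le_norm _ _).trans (mul_le_of_le_one_right (norm_nonneg _) (hz n))
  have hgg : ∑ n, Real.exp (-⟪v, z n⟫) * ⟪g, z n⟫ = ‖g‖ ^ 2 := by
    rw [← real_inner_self_eq_norm_sq]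
    conv_rhs => rw [hg, inner_sum]
    refine Finset.sum_congr rfl fun n _ => ?_
    rw [inner_smul_right, ← hg]
  have hterm : ∀ n, Real.exp (-⟪v + η • g, z n⟫) ≤ Real.exp (-⟪v, z n⟫)
      - η * (Real.exp (-⟪v, z n⟫) * ⟪g, z n⟫) + Real.exp (-⟪v, z n⟫) * (η ^ 2 * ‖g‖ ^ 2) := by
    intro n
    -- The step size condition keeps the exponent in `[-1, 1]`, where `exp s ≤ 1 + s + s ^ 2`.
    have h1 : |-(η * ⟪g, z n⟫)| ≤ 1 := by
      rw [abs_neg, abs_mul, abs_of_pos hη]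
      calc η * |⟪g, z n⟫| ≤ η * L := by gcongr; exact (hgz n).trans hgL
        _ ≤ 1 := hηv
    have h2 := (abs_le.1 (Real.abs_exp_sub_one_sub_id_le h1)).2
    have h3 : ⟪g, z n⟫ ^ 2 ≤ ‖g‖ ^ 2 := by
      rw [← sq_abs]; exact pow_le_pow_left₀ (abs_nonneg _) (hgz n) 2
    rw [inner_add_left, real_inner_smul_left, neg_add, Real.exp_add]
    have h4 : Real.exp (-(η * ⟪g, z n⟫)) ≤ 1 - η * ⟪g, z n⟫ + η ^ 2 * ‖g‖ ^ 2 := by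
      nlinarith [mul_le_mul_of_nonneg_left h3 (sq_nonneg η)]
    calc _ ≤ Real.exp (-⟪v, z n⟫) * (1 - η * ⟪g, z n⟫ + η ^ 2 * ‖g‖ ^ 2) := by gcongr
      _ = _ := by ring
  refine (Finset.sum_le_sum fun n _ => hterm n).trans (le_of_eq ?_)
  rw [Finset.sum_add_distrib, Finset.sum_sub_distrib, ← Finset.mul_sum, ← Finset.sum_mul, hgg]
  ring

theorem summable_norm_sq_gd_step (hz : ∀ n, ‖z n‖ ≤ 1) {η : ℝ} (hη : 0 < η) {w : ℕ → E}
    (hw : ∀ m, w (m + 1) = w m + η • ∑ n, Real.exp (-⟪w m, z n⟫) • z n)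
    (hη0 : η * ∑ n, Real.exp (-⟪w 0, z n⟫) < 1) :
    Summable fun m => ‖w (m + 1) - w m‖ ^ 2 := by
  set L : ℕ → ℝ := fun m => ∑ n, Real.exp (-⟪w m, z n⟫) with hL
  have hL0 : ∀ m, 0 ≤ L m := fun m => Finset.sum_nonneg fun n _ => (Real.exp_pos _).le
  have hstep : ∀ m, η * L m ≤ 1 → L (m + 1) ≤ L m - η * (1 - η * L m) *
      ‖∑ k, Real.exp (-⟪w m, z k⟫) • z k‖ ^ 2 := by
    intro m hm
    have := expLoss_descent hz hη (w m) hm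
    rwa [← hw] at this
  -- The loss never exceeds its initial value, so the step size condition persists and the factor `1
  -- - η * L 0` serves every step.
  have hmono : ∀ m, L m ≤ L 0 := by
    intro m
    induction m with
    | zero => rfl
    | succ m ih =>
      have h1 : η * L m ≤ 1 := (mul_le_mul_of_nonneg_left ih hη.le).trans hη0.le
      have : 0 ≤ η * (1 - η * L m) * ‖∑ k, Real.exp (-⟪w m, z k⟫) • z k‖ ^ 2 := by
        have : 0 ≤ 1 - η * L m := by linarith
        positivity
      linarith [hstep m h1]
  have hδ : 0 < 1 - η * L 0 := by linarith
  have hstep' : ∀ m, (1 - η * L 0) * ‖w (m + 1) - w m‖ ^ 2 ≤ η * (L m - L (m + 1)) := by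
    intro m
    have h0 : η * L m ≤ η * L 0 := mul_le_mul_of_nonneg_left (hmono m) hη.le
    have h1 := hstep m (h0.trans hη0.le)
    rw [hw, add_sub_cancel_left, norm_smul, Real.norm_of_nonneg hη.le]
    set G := ‖∑ k, Real.exp (-⟪w m, z k⟫) • z k‖ ^ 2
    have hG : 0 ≤ G := sq_nonneg _
    have h2 : (1 - η * L 0) * G ≤ (1 - η * L m) * G := by gcongr
    rw [mul_pow]
    nlinarith [mul_le_mul_of_nonneg_left h2 (sq_nonneg η), mul_le_mul_of_nonneg_left h1 hη.le]
  refine (summable_mul_left_iff hδ.ne').1 ?_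
  refine summable_of_sum_range_le (c := η * L 0)
    (fun m => mul_nonneg hδ.le (sq_nonneg _)) fun m => ?_
  refine (Finset.sum_le_sum fun k _ => hstep' k).trans ?_
  rw [← Finset.mul_sum, Finset.sum_range_sub']
  exact mul_le_mul_of_nonneg_left (by linarith [hL0 m]) hη.le

end Descent

/-! ### Choice of the offset and decay of dissipative sequences -/

section Asymptotics

variable {E ι : Type*} [NormedAddCommGroup E] [InnerProductSpace ℝ E] {z : ι → E}

theorem eq_zero_of_mem_span_of_inner_eq_zero {s : Set ι} {v : E}
    (hv : v ∈ Submodule.span ℝ (z '' s)) (h : ∀ n ∈ s, ⟪v, z n⟫ = 0) : v = 0 := by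
  have key : ∀ y ∈ Submodule.span ℝ (z '' s), ⟪v, y⟫ = 0 := by
    intro y hy
    induction hy using Submodule.span_induction with
    | mem y hy => obtain ⟨n, hn, rfl⟩ := hy; exact h n hn
    | zero => simp
    | add a b _ _ ha hb => rw [inner_add_right, ha, hb, add_zero]
    | smul c a _ ha => rw [inner_smul_right, ha, mul_zero]
  exact inner_self_eq_zero.1 (key v hv)

/-- Gives coercivity when `a > 0`: for `t ≤ 0`, `exp (-t) ≥ t ^ 2 / 2`, and completing the square
yields the constant. -/
theorem mul_abs_sub_le_exp_neg_add {η : ℝ} (hη : 0 < η) (a t : ℝ) :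
    a * |t| - 2 * a ^ 2 / η ≤ η * Real.exp (-t) + a * t := by
  rcases le_total 0 t with ht | ht
  · rw [abs_of_nonneg ht]
    have : 0 ≤ 2 * a ^ 2 / η := by positivity
    have : 0 < η * Real.exp (-t) := by positivity
    linarith
  · rw [abs_of_nonpos ht]
    have h1 := Real.quadratic_le_exp_of_nonneg (neg_nonneg.2 ht)
    have h2 : η * (t ^ 2 / 2) ≤ η * Real.exp (-t) := by
      gcongr
      nlinarith
    have h3 : η * (t ^ 2 / 2) + 2 * a * t + 2 * a ^ 2 / η = (η * t + 2 * a) ^ 2 / (2 * η) := by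
      field_simp
      ring
    have h4 : 0 ≤ (η * t + 2 * a) ^ 2 / (2 * η) := by positivity
    linarith

variable [FiniteDimensional ℝ E]

/-- Exponential weights can be balanced against any positive weights by a translation along the
span of the vectors. -/
theorem exists_sum_exp_smul_eq {T : Finset ι} {α : ι → ℝ} (hα : ∀ n ∈ T, 0 < α n)
    {η : ℝ} (hη : 0 < η) (w₀ : E) :
    ∃ v ∈ Submodule.span ℝ (z '' T),
      ∑ n ∈ T, (η * Real.exp (-⟪w₀ + v, z n⟫)) • z n = ∑ n ∈ T, α n • z n := by
  set V := Submodule.span ℝ (z '' (T : Set ι)) with hV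
  -- A potential with gradient `∑ (α n - η exp(-⟪w₀ + v, z n⟫)) z n`; a critical point on the span
  -- solves the balance equation.
  let f : E → ℝ := fun v => ∑ n ∈ T, (η * Real.exp (-⟪w₀ + v, z n⟫) + α n * ⟪w₀ + v, z n⟫)
  have hfc : Continuous f := by fun_prop
  -- A vector of the span orthogonal to all generators is zero, so `A` is injective, hence bounded
  -- below in finite dimension.
  let A : V →ₗ[ℝ] (T → ℝ) := LinearMap.pi fun n => α n • (innerₛₗ ℝ (z n)) ∘ₗ V.subtype
  have hA : ∀ v n, A v n = α n * ⟪(v : E), z n⟫ := fun v n => by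
    simp [A, real_inner_comm]
  have hker : A.ker = ⊥ := by
    rw [LinearMap.ker_eq_bot']
    intro v hv
    refine Subtype.ext (eq_zero_of_mem_span_of_inner_eq_zero v.2 fun n hn => ?_)
    have := congrFun hv ⟨n, hn⟩
    rw [hA] at this
    exact (mul_eq_zero.1 this).resolve_left (hα n hn).ne'
  obtain ⟨K, hK, hAK⟩ := A.exists_antilipschitzWith hker
  have hnorm : ∀ v : V, ‖v‖ ≤ K * ∑ n ∈ T, α n * |⟪(v : E), z n⟫| := by
    intro v
    refine (hAK.le_mul_norm (map_zero A) v).trans ?_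
    gcongr
    have h0 : ∀ n ∈ T, 0 ≤ α n * |⟪(v : E), z n⟫| := fun n hn =>
      mul_nonneg (hα n hn).le (abs_nonneg _)
    rw [pi_norm_le_iff_of_nonneg (Finset.sum_nonneg h0)]
    rintro ⟨n, hn⟩
    rw [hA, Real.norm_eq_abs, abs_mul, abs_of_pos (hα n hn)]
    exact Finset.single_le_sum (f := fun n => α n * |⟪(v : E), z n⟫|) h0 hn
  set C := ∑ n ∈ T, (α n * |⟪w₀, z n⟫| + 2 * α n ^ 2 / η) with hC
  have hlow : ∀ v : V, (K : ℝ)⁻¹ * ‖v‖ - C ≤ f v := by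
    intro v
    have h1 : (K : ℝ)⁻¹ * ‖v‖ ≤ ∑ n ∈ T, α n * |⟪(v : E), z n⟫| := by
      rw [inv_mul_le_iff₀ (by exact_mod_cast hK)]
      exact hnorm v
    refine (sub_le_sub_right h1 C).trans ?_
    rw [hC, ← Finset.sum_sub_distrib]
    refine Finset.sum_le_sum fun n hn => ?_
    have h2 := mul_abs_sub_le_exp_neg_add hη (α n) ⟪w₀ + v, z n⟫
    have h3 : |⟪(v : E), z n⟫| ≤ |⟪w₀ + v, z n⟫| + |⟪w₀, z n⟫| := by
      have := abs_sub ⟪w₀ + v, z n⟫ ⟪w₀, z n⟫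
      rwa [inner_add_left, add_sub_cancel_left, ← inner_add_left] at this
    have h4 := mul_le_mul_of_nonneg_left h3 (hα n hn).le
    linarith
  obtain ⟨v, hv⟩ : ∃ v : V, ∀ y : V, f v ≤ f y := by
    refine Continuous.exists_forall_le (hfc.comp continuous_subtype_val) ?_
    refine tendsto_atTop_mono hlow (tendsto_atTop_add_const_right _ _ ?_)
    exact tendsto_norm_cocompact_atTop.const_mul_atTop (by positivity)
  refine ⟨v, v.2, ?_⟩
  rw [← sub_eq_zero, ← Finset.sum_sub_distrib]
  -- The defect itself is the test direction: it lies in the span, and the derivative of `f` along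
  -- it is `-‖g‖ ^ 2`.
  set g := ∑ n ∈ T, ((η * Real.exp (-⟪w₀ + v, z n⟫)) • z n - α n • z n) with hg
  have hgV : g ∈ V := Submodule.sum_mem _ fun n hn =>
    have hzn : z n ∈ V := Submodule.subset_span ⟨n, hn, rfl⟩
    V.sub_mem (V.smul_mem _ hzn) (V.smul_mem _ hzn)
  have hderiv : HasDerivAt (fun t : ℝ => f (v + t • g))
      (∑ n ∈ T, (η * (Real.exp (-⟪w₀ + v, z n⟫) * -⟪g, z n⟫) + α n * ⟪g, z n⟫)) 0 := by
    have hlin : ∀ n, HasDerivAt (fun t : ℝ => ⟪w₀ + (v + t • g), z n⟫) ⟪g, z n⟫ 0 := by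
      intro n
      have : (fun t : ℝ => ⟪w₀ + (v + t • g), z n⟫) =
          fun t : ℝ => ⟪w₀ + v, z n⟫ + t * ⟪g, z n⟫ := by
        ext t
        rw [← add_assoc, inner_add_left _ (t • g), real_inner_smul_left]
      rw [this]
      simpa using ((hasDerivAt_id (0 : ℝ)).mul_const ⟪g, z n⟫).const_add ⟪w₀ + v, z n⟫
    refine HasDerivAt.fun_sum fun n _ => ?_
    have := (((hlin n).fun_neg.exp).const_mul η).fun_add ((hlin n).const_mul (α n))
    simpa using this
  have hmin : IsLocalMin (fun t : ℝ => f (v + t • g)) 0 := by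
    refine Eventually.of_forall fun t => ?_
    have := hv (v + t • ⟨g, hgV⟩)
    simpa using this
  have h0 := hmin.hasDerivAt_eq_zero hderiv
  have hgg : ⟪g, g⟫ = 0 := by
    conv_lhs => rw [hg, inner_sum]
    rw [← neg_eq_zero, ← Finset.sum_neg_distrib, ← h0]
    refine Finset.sum_congr rfl fun n _ => ?_
    rw [inner_sub_right, inner_smul_right, inner_smul_right]
    ring
  exact inner_self_eq_zero.1 hgg

theorem one_sub_exp_neg_mul_self_nonneg (t : ℝ) : 0 ≤ (1 - Real.exp (-t)) * t := by
  rcases le_total 0 t with ht | ht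
  · exact mul_nonneg (sub_nonneg.2 (Real.exp_le_one_iff.2 (neg_nonpos.2 ht))) ht
  · exact mul_nonneg_of_nonpos_of_nonpos
      (sub_nonpos.2 (Real.one_le_exp_iff.2 (neg_nonneg.2 ht))) ht

theorem eq_zero_of_one_sub_exp_neg_mul_self {t : ℝ} (h : (1 - Real.exp (-t)) * t = 0) :
    t = 0 := by
  rcases mul_eq_zero.1 h with h | h
  · have : Real.exp (-t) = 1 := by linarith
    simpa using this
  · exact h

/-- Bounds the push of non-support vectors on the residual independently of its size. -/
theorem exp_neg_mul_self_le_one (t : ℝ) : Real.exp (-t) * t ≤ 1 := by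
  have h := (lt_add_one t).le.trans (Real.add_one_le_exp t)
  calc Real.exp (-t) * t ≤ Real.exp (-t) * Real.exp t := by gcongr
    _ = 1 := by rw [← Real.exp_add]; simp

/-- A sequence in the span of the `z n`, `n ∈ T`, that dissipates `∑ α (1 - e⁻ᵗ) t` at rate
`1 / m`, up to summable errors, tends to zero. -/
theorem tendsto_norm_zero_of_dissipation {T : Finset ι} {α : ι → ℝ} (hα : ∀ n ∈ T, 0 < α n)
    {u : ℕ → E} (huV : ∀ m, u m ∈ Submodule.span ℝ (z '' T)) {c : ℕ → ℝ} (hc : ∀ m, 0 ≤ c m)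
    (hcs : Summable c)
    (h : ∀ m : ℕ, ‖u (m + 1)‖ ^ 2 ≤ ‖u m‖ ^ 2 + c m * (1 + ‖u m‖ ^ 2) -
      1 / ((m : ℝ) + 1) * ∑ n ∈ T, α n * ((1 - Real.exp (-⟪u m, z n⟫)) * ⟪u m, z n⟫)) :
    Tendsto (fun m => ‖u m‖) atTop (𝓝 0) := by
  set D : E → ℝ := fun v => ∑ n ∈ T, α n * ((1 - Real.exp (-⟪v, z n⟫)) * ⟪v, z n⟫) with hD
  have hDterm : ∀ v, ∀ n ∈ T, 0 ≤ α n * ((1 - Real.exp (-⟪v, z n⟫)) * ⟪v, z n⟫) := fun v n hn =>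
    mul_nonneg (hα n hn).le (one_sub_exp_neg_mul_self_nonneg _)
  have hD0 : ∀ v, 0 ≤ D v := fun v => Finset.sum_nonneg (hDterm v)
  have hDc : Continuous D := by fun_prop
  obtain ⟨⟨l, hl⟩, hsum⟩ := robbins_siegmund (a := fun m => ‖u m‖ ^ 2)
    (s := fun m : ℕ => 1 / ((m : ℝ) + 1) * D (u m)) (fun m => sq_nonneg _) hc
    (fun m => mul_nonneg (by positivity) (hD0 _)) hcs h
  have hl0 : 0 ≤ l := ge_of_tendsto' hl fun m => sq_nonneg _
  suffices hl' : l = 0 by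
    have := (Real.continuous_sqrt.tendsto l).comp hl
    simpa [Function.comp_def, hl', Real.sqrt_sq] using this
  by_contra hne
  have hlpos : 0 < l := lt_of_le_of_ne hl0 (Ne.symm hne)
  -- If `l > 0`, the sequence eventually stays in this compact shell, on which `D` has a positive
  -- minimum because its only zero in the span is `0`.
  let Q : Set E := {v | v ∈ Submodule.span ℝ (z '' (T : Set ι)) ∧
    l / 2 ≤ ‖v‖ ^ 2 ∧ ‖v‖ ^ 2 ≤ l + 1}
  have hQ : IsCompact Q := by
    refine (isCompact_closedBall (0 : E) (l + 2)).of_isClosed_subset ?_ ?_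
    · have h1 : IsClosed {v : E | l / 2 ≤ ‖v‖ ^ 2} := isClosed_le continuous_const (by fun_prop)
      have h2 : IsClosed {v : E | ‖v‖ ^ 2 ≤ l + 1} := isClosed_le (by fun_prop) continuous_const
      exact (Submodule.closed_of_finiteDimensional _).inter (h1.inter h2)
    · rintro v ⟨-, -, hv⟩
      rw [mem_closedBall_zero_iff]
      nlinarith [norm_nonneg v]
  have hev : ∀ᶠ m in atTop, u m ∈ Q := by
    filter_upwards [hl.eventually_const_le (show l / 2 < l by linarith),
      hl.eventually_le_const (show l < l + 1 by linarith)] with m h1 h2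
    exact ⟨huV m, h1, h2⟩
  have hQne : Q.Nonempty := let ⟨m, hm⟩ := hev.exists; ⟨_, hm⟩
  obtain ⟨v, hvQ, hvmin⟩ := hQ.exists_isMinOn hQne hDc.continuousOn
  have hDv : 0 < D v := by
    refine lt_of_le_of_ne (hD0 v) fun h0 => ?_
    have h1 := (Finset.sum_eq_zero_iff_of_nonneg (hDterm v)).1 h0.symm
    have hv0 : v = 0 := eq_zero_of_mem_span_of_inner_eq_zero hvQ.1 fun n hn =>
      eq_zero_of_one_sub_exp_neg_mul_self
        ((mul_eq_zero.1 (h1 n hn)).resolve_left (hα n hn).ne')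
    have := hvQ.2.1
    rw [hv0] at this
    simp at this
    linarith
  have hsum' : Summable fun m : ℕ => 1 / ((m : ℝ) + 1) * D v := by
    refine summable_of_isBigO_nat hsum (Asymptotics.IsBigO.of_bound 1 ?_)
    filter_upwards [hev] with m hm
    have h1 : (0 : ℝ) ≤ 1 / ((m : ℝ) + 1) := by positivity
    rw [one_mul, Real.norm_of_nonneg (mul_nonneg h1 hDv.le),
      Real.norm_of_nonneg (mul_nonneg h1 (hD0 _))]
    exact mul_le_mul_of_nonneg_left (hvmin hm) h1
  have hsum'' := (summable_mul_right_iff hDv.ne').1 hsum'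
  refine Real.not_summable_one_div_natCast ((summable_nat_add_iff 1).1 ?_)
  simpa using hsum''

end Asymptotics

/-! ### Recursion for the gradient descent residual -/

section Residual

variable {E ι : Type*} [NormedAddCommGroup E] [InnerProductSpace ℝ E] [Fintype ι] {z : ι → E}

/-- The increment of `log` replaces the harmonic step `1 / p` at a summable cost. -/
theorem log_add_one_sub_log_mem {p : ℝ} (hp : 0 < p) :
    0 ≤ Real.log (p + 1) - Real.log p ∧ Real.log (p + 1) - Real.log p ≤ 1 / p ∧
      1 / p - (Real.log (p + 1) - Real.log p) ≤ 1 / p ^ 2 := by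
  rw [← Real.log_div (by positivity) hp.ne']
  have hq : (p + 1) / p = 1 + 1 / p := by field_simp
  have hpos : 0 < (p + 1) / p := by positivity
  refine ⟨Real.log_nonneg (by rw [hq]; linarith [one_div_pos.2 hp]), ?_, ?_⟩
  · linarith [Real.log_le_sub_one_of_pos hpos]
  · have h1 := Real.one_sub_inv_le_log_of_pos hpos
    have h2 : 1 / p - (1 - ((p + 1) / p)⁻¹) ≤ 1 / p ^ 2 := by
      have : 1 / p - (1 - ((p + 1) / p)⁻¹) = 1 / (p ^ 2 + p) := by field_simp; ring
      rw [this]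
      exact one_div_le_one_div_of_le (by positivity) (by linarith)
    linarith

theorem gd_sub_mem {V : Submodule ℝ E} (hzV : ∀ n, z n ∈ V) {η : ℝ} {w : ℕ → E}
    (hw : ∀ m, w (m + 1) = w m + η • ∑ n, Real.exp (-⟪w m, z n⟫) • z n) {wt : E}
    (h0 : w 0 - wt ∈ V) (m : ℕ) : w m - wt ∈ V := by
  induction m with
  | zero => exact h0
  | succ m ih =>
    rw [hw, add_sub_right_comm]
    exact V.add_mem ih (V.smul_mem _ (V.sum_mem fun n _ => V.smul_mem _ (hzV n)))

/-- One step of the recursion for the squared norm of the residual of gradient descent. -/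
theorem residual_step {T : Finset ι} {α : ι → ℝ} (hα : ∀ n ∈ T, 0 < α n) {wh : E}
    (hwh : wh = ∑ n ∈ T, α n • z n) (hT : ∀ n ∈ T, ⟪wh, z n⟫ = 1)
    {η : ℝ} (hη : 0 < η) {wt : E} (hwt : ∀ n ∈ T, η * Real.exp (-⟪wt, z n⟫) = α n)
    {p : ℝ} (hp : 1 ≤ p) {v v' u u' : E} (hv' : v' = v + η • ∑ n, Real.exp (-⟪v, z n⟫) • z n)
    (hu : u = v - Real.log p • wh - wt) (hu' : u' = v' - Real.log (p + 1) • wh - wt)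
    [DecidableEq ι] :
    ‖u'‖ ^ 2 ≤ ‖u‖ ^ 2 + (2 * ‖wh‖ * (1 / p ^ 2) +
        2 * ∑ n ∈ Tᶜ, η * Real.exp (-⟪wt, z n⟫) * p ^ (-⟪wh, z n⟫) +
        2 * ‖v' - v‖ ^ 2 + 2 * ‖wh‖ ^ 2 * (1 / p ^ 2)) * (1 + ‖u‖ ^ 2) -
      1 / p * ∑ n ∈ T, α n * ((1 - Real.exp (-⟪u, z n⟫)) * ⟪u, z n⟫) := by
  have hp0 : 0 < p := by linarith
  obtain ⟨hδ0, hδ1, hδ2⟩ := log_add_one_sub_log_mem hp0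
  set δ := Real.log (p + 1) - Real.log p with hδ
  set D := ∑ n ∈ T, α n * ((1 - Real.exp (-⟪u, z n⟫)) * ⟪u, z n⟫) with hD
  set e := ∑ n ∈ Tᶜ, η * Real.exp (-⟪wt, z n⟫) * p ^ (-⟪wh, z n⟫) with he
  have hv : v = u + Real.log p • wh + wt := by rw [hu]; abel
  have huu : u' = u + ((v' - v) - δ • wh) := by rw [hu, hu', hδ, sub_smul]; abel
  have hexp : ∀ n, Real.exp (-⟪v, z n⟫) =
      Real.exp (-⟪wt, z n⟫) * p ^ (-⟪wh, z n⟫) * Real.exp (-⟪u, z n⟫) := by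
    intro n
    rw [Real.rpow_def_of_pos hp0, ← Real.exp_add, ← Real.exp_add, hv, inner_add_left,
      inner_add_left, real_inner_smul_left]
    congr 1
    ring
  have huwh : ⟪u, wh⟫ = ∑ n ∈ T, α n * ⟪u, z n⟫ := by
    rw [hwh, inner_sum]
    exact Finset.sum_congr rfl fun n _ => inner_smul_right _ _ _
  -- Support weights are `α n / p * e⁻ᵗ`; splitting `e⁻ᵗ t = t - (1 - e⁻ᵗ) t` separates the drift
  -- from the dissipation.
  have hsuppT : ∑ n ∈ T, η * (Real.exp (-⟪v, z n⟫) * ⟪u, z n⟫) =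
      1 / p * (⟪u, wh⟫ - D) := by
    rw [huwh, hD, ← Finset.sum_sub_distrib, Finset.mul_sum]
    refine Finset.sum_congr rfl fun n hn => ?_
    rw [hexp, hT n hn, Real.rpow_neg_one, ← hwt n hn]
    ring
  have hsuppC : ∑ n ∈ Tᶜ, η * (Real.exp (-⟪v, z n⟫) * ⟪u, z n⟫) ≤ e := by
    refine Finset.sum_le_sum fun n _ => ?_
    rw [hexp]
    have h1 := exp_neg_mul_self_le_one ⟪u, z n⟫
    have h2 : 0 ≤ η * Real.exp (-⟪wt, z n⟫) * p ^ (-⟪wh, z n⟫) := by positivity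
    calc _ = η * Real.exp (-⟪wt, z n⟫) * p ^ (-⟪wh, z n⟫) *
          (Real.exp (-⟪u, z n⟫) * ⟪u, z n⟫) := by ring
      _ ≤ _ := mul_le_of_le_one_right h2 h1
  have hinner : ⟪u, v' - v⟫ ≤ 1 / p * (⟪u, wh⟫ - D) + e := by
    have : ⟪u, v' - v⟫ = ∑ n, η * (Real.exp (-⟪v, z n⟫) * ⟪u, z n⟫) := by
      rw [hv', add_sub_cancel_left, inner_smul_right, inner_sum, Finset.mul_sum]
      exact Finset.sum_congr rfl fun n _ => by rw [inner_smul_right]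
    rw [this, ← Finset.sum_add_sum_compl T, hsuppT]
    linarith
  -- The cross term yields `-2 * D / p`; its sign allows one copy to be dropped.
  have hD0 : 0 ≤ 1 / p * D := mul_nonneg (by positivity) <| Finset.sum_nonneg fun n hn =>
    mul_nonneg (hα n hn).le (one_sub_exp_neg_mul_self_nonneg _)
  have he0 : 0 ≤ e := Finset.sum_nonneg fun n _ => by positivity
  have hcross : (1 / p - δ) * ⟪u, wh⟫ ≤ ‖wh‖ * (1 / p ^ 2) * (1 + ‖u‖ ^ 2) := by
    have h1 : ‖u‖ ≤ 1 + ‖u‖ ^ 2 := by nlinarith [sq_nonneg (‖u‖ - 1), norm_nonneg u]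
    have h0 : 0 ≤ 1 / p - δ := by linarith
    calc (1 / p - δ) * ⟪u, wh⟫ ≤ 1 / p ^ 2 * (‖u‖ * ‖wh‖) := by
          refine (mul_le_mul_of_nonneg_left (real_inner_le_norm u wh) h0).trans ?_
          gcongr
      _ ≤ 1 / p ^ 2 * ((1 + ‖u‖ ^ 2) * ‖wh‖) := by gcongr
      _ = _ := by ring
  have hΔ : ‖(v' - v) - δ • wh‖ ^ 2 ≤ 2 * ‖v' - v‖ ^ 2 + 2 * ‖wh‖ ^ 2 * (1 / p ^ 2) := by
    have h1 : ‖δ • wh‖ ^ 2 ≤ ‖wh‖ ^ 2 * (1 / p ^ 2) := by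
      rw [norm_smul, Real.norm_of_nonneg hδ0, mul_pow, mul_comm]
      have : δ ^ 2 ≤ 1 / p ^ 2 := by
        rw [← one_div_pow]; exact pow_le_pow_left₀ hδ0 hδ1 2
      gcongr
    have h2 := pow_le_pow_left₀ (norm_nonneg _) (norm_sub_le (v' - v) (δ • wh)) 2
    nlinarith [sq_nonneg (‖v' - v‖ - ‖δ • wh‖)]
  have hrest : e + ‖(v' - v) - δ • wh‖ ^ 2 + e ≤
      (2 * e + 2 * ‖v' - v‖ ^ 2 + 2 * ‖wh‖ ^ 2 * (1 / p ^ 2)) * (1 + ‖u‖ ^ 2) := by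
    have h0 : 0 ≤ 2 * e + 2 * ‖v' - v‖ ^ 2 + 2 * ‖wh‖ ^ 2 * (1 / p ^ 2) :=
      add_nonneg (add_nonneg (mul_nonneg zero_le_two he0) (by positivity)) (by positivity)
    have h1 := mul_nonneg h0 (sq_nonneg ‖u‖)
    linarith
  rw [huu, norm_add_sq_real, inner_sub_right, inner_smul_right]
  linarith

/-- The iterates of gradient descent are asymptotic to `log M • wh + wt`. -/
theorem tendsto_gd_residual [FiniteDimensional ℝ E] {T : Finset ι} {α : ι → ℝ}
    (hα : ∀ n ∈ T, 0 < α n) {wh : E}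
    (hwh : wh = ∑ n ∈ T, α n • z n) (hT : ∀ n ∈ T, ⟪wh, z n⟫ = 1)
    (hTc : ∀ n ∉ T, 1 < ⟪wh, z n⟫) (hzV : ∀ n, z n ∈ Submodule.span ℝ (z '' T))
    {η : ℝ} (hη : 0 < η) {wt : E} (hwt : ∀ n ∈ T, η * Real.exp (-⟪wt, z n⟫) = α n) {w : ℕ → E}
    (hw : ∀ m, w (m + 1) = w m + η • ∑ n, Real.exp (-⟪w m, z n⟫) • z n)
    (h0 : w 0 - wt ∈ Submodule.span ℝ (z '' T))
    (hsum : Summable fun m => ‖w (m + 1) - w m‖ ^ 2) :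
    Tendsto (fun M : ℕ => ‖w M - Real.log M • wh - wt‖) atTop (𝓝 0) := by
  classical
  -- The recursion starts at `M = 1`, since it needs `p ≥ 1`.
  rw [← tendsto_add_atTop_iff_nat 1]
  have hwhV : wh ∈ Submodule.span ℝ (z '' (T : Set ι)) := by
    rw [hwh]; exact Submodule.sum_mem _ fun n _ => Submodule.smul_mem _ _ (hzV n)
  have hsq : Summable fun m : ℕ => 1 / (((m + 1 : ℕ) : ℝ)) ^ 2 :=
    (summable_nat_add_iff 1).2 (Real.summable_one_div_nat_pow.2 one_lt_two)
  refine tendsto_norm_zero_of_dissipation (z := z) hα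
    (u := fun m => w (m + 1) - Real.log ((m + 1 : ℕ) : ℝ) • wh - wt)
    (c := fun m => 2 * ‖wh‖ * (1 / ((m + 1 : ℕ) : ℝ) ^ 2) +
      2 * ∑ n ∈ Tᶜ, η * Real.exp (-⟪wt, z n⟫) * ((m + 1 : ℕ) : ℝ) ^ (-⟪wh, z n⟫) +
      2 * ‖w (m + 1 + 1) - w (m + 1)‖ ^ 2 + 2 * ‖wh‖ ^ 2 * (1 / ((m + 1 : ℕ) : ℝ) ^ 2))
    (fun m => ?_) (fun m => ?_) ?_ fun m => ?_
  · rw [sub_right_comm]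
    exact Submodule.sub_mem _ (gd_sub_mem hzV hw h0 _) (Submodule.smul_mem _ _ hwhV)
  · have : 0 ≤ ∑ n ∈ Tᶜ, η * Real.exp (-⟪wt, z n⟫) * ((m + 1 : ℕ) : ℝ) ^ (-⟪wh, z n⟫) :=
      Finset.sum_nonneg fun n _ => by positivity
    positivity
  · refine (((hsq.mul_left _).add (Summable.mul_left _ ?_)).add
      (((summable_nat_add_iff 1).2 hsum).mul_left _)).add (hsq.mul_left _)
    refine summable_sum fun n hn => Summable.mul_left _ ?_
    refine (summable_nat_add_iff (f := fun k : ℕ => (k : ℝ) ^ (-⟪wh, z n⟫)) 1).2 ?_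
    exact Real.summable_nat_rpow.2 (by linarith [hTc n (Finset.mem_compl.1 hn)])
  · have := residual_step hα hwh hT hη hwt (p := ((m + 1 : ℕ) : ℝ)) 
      (by exact_mod_cast Nat.le_add_left 1 m) (hw (m + 1)) rfl rfl
    push_cast at this ⊢
    exact this

end Residual

/-! ### Hard-margin duality -/

section HardMargin

variable {E ι : Type*} [NormedAddCommGroup E] [InnerProductSpace ℝ E] {z : ι → E}

theorem convex_setOf_one_le_inner : Convex ℝ {w : E | ∀ n, 1 ≤ ⟪w, z n⟫} := by
  intro v hv w hw a b ha hb hab n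
  rw [inner_add_left, real_inner_smul_left, real_inner_smul_left]
  nlinarith [mul_le_mul_of_nonneg_left (hv n) ha, mul_le_mul_of_nonneg_left (hw n) hb]

theorem isClosed_setOf_one_le_inner : IsClosed {w : E | ∀ n, 1 ≤ ⟪w, z n⟫} := by
  rw [Set.ofPred_forall]
  exact isClosed_iInter fun n => isClosed_le continuous_const (by fun_prop)

/-- A nonempty closed convex set has a unique point of minimal norm. -/
theorem existsUnique_isMinOn_norm_sq [CompleteSpace E] {K : Set E} (hK : K.Nonempty)
    (hc : IsClosed K) (hconv : Convex ℝ K) :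
    ∃! w, w ∈ K ∧ IsMinOn (fun v => ‖v‖ ^ 2) K w := by
  obtain ⟨w, hwK, hw⟩ := exists_norm_eq_iInf_of_complete_convex hK hc.isComplete hconv 0
  have hle := (norm_eq_iInf_iff_real_inner_le_zero hconv hwK).1 hw
  -- The obtuse angle property of the projection of `0`; the extra square gives uniqueness.
  have hle' : ∀ v ∈ K, ‖w‖ ^ 2 + ‖v - w‖ ^ 2 ≤ ‖v‖ ^ 2 := by
    intro v hv
    have h1 := hle v hv
    rw [zero_sub, inner_neg_left] at h1
    have h2 := norm_add_sq_real w (v - w)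
    rw [add_sub_cancel] at h2
    linarith
  refine ⟨w, ⟨hwK, fun v hv => ?_⟩, ?_⟩
  · change ‖w‖ ^ 2 ≤ ‖v‖ ^ 2
    linarith [hle' v hv, sq_nonneg ‖v - w‖]
  · rintro v ⟨hvK, hv⟩
    have h1 : ‖v‖ ^ 2 ≤ ‖w‖ ^ 2 := hv hwK
    have h2 : ‖v - w‖ ^ 2 = 0 := le_antisymm (by linarith [hle' v hvK]) (sq_nonneg _)
    exact sub_eq_zero.1 (norm_eq_zero.1 (pow_eq_zero_iff two_ne_zero |>.1 h2))

variable [Fintype ι]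

/-- Complementary slackness expresses the squared norm of the primal solution as a sum of
multipliers. -/
theorem sum_eq_norm_sq_of_slackness {α : ι → ℝ} {w : E} (hw : w = ∑ n, α n • z n)
    (hslack : ∀ n, α n * ⟪w, z n⟫ = α n) : ∑ n, α n = ‖w‖ ^ 2 := by
  rw [← real_inner_self_eq_norm_sq]
  conv_rhs => rw [hw, inner_sum]
  refine Finset.sum_congr rfl fun n _ => ?_
  rw [inner_smul_right, ← hw, hslack]

/-- The dual solution of the hard-margin problem represents a primal solution. -/
theorem primal_of_dual {α : ι → ℝ} (hα : ∀ n, 0 ≤ α n)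
    (hmax : ∀ β : ι → ℝ, (∀ n, 0 ≤ β n) →
      ∑ n, β n - 1 / 2 * ‖∑ n, β n • z n‖ ^ 2 ≤ ∑ n, α n - 1 / 2 * ‖∑ n, α n • z n‖ ^ 2) :
    (∀ n, 1 ≤ ⟪∑ k, α k • z k, z n⟫) ∧
      ∀ w, (∀ n, 1 ≤ ⟪w, z n⟫) → ‖∑ k, α k • z k‖ ^ 2 ≤ ‖w‖ ^ 2 := by
  classical
  set v := ∑ k, α k • z k with hv
  -- One-coordinate variation of `α`: small `t > 0` forces feasibility, small `t < 0` at a positive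
  -- multiplier forces slackness.
  have hpert : ∀ n, ∀ t : ℝ, 0 ≤ α n + t → t * (1 - ⟪v, z n⟫) ≤ t ^ 2 * (‖z n‖ ^ 2 / 2) := by
    intro n t ht
    have h1 := hmax (α + Pi.single n t) (fun k => by
      by_cases hk : k = n
      · subst hk; simpa using ht
      · simpa [hk] using hα k)
    have h2 : ∑ k, (α + Pi.single n t : ι → ℝ) k • z k = v + t • z n := by
      simp only [Pi.add_apply, add_smul, Finset.sum_add_distrib, ← hv]
      simp [Pi.single_apply, ite_smul]
    have h3 : ∑ k, (α + Pi.single n t : ι → ℝ) k = ∑ k, α k + t := by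
      simp [Finset.sum_add_distrib]
    rw [h2, h3, norm_add_sq_real, inner_smul_right, norm_smul, mul_pow, Real.norm_eq_abs,
      sq_abs] at h1
    linarith
  have hfeas : ∀ n, 1 ≤ ⟪v, z n⟫ := by
    intro n
    by_contra! hlt
    set q := ‖z n‖ ^ 2 / 2 with hq
    have hq0 : 0 ≤ q := by positivity
    set ε := 1 - ⟪v, z n⟫ with hε
    have hε0 : 0 < ε := by linarith
    have ht : 0 < ε / (q + 1) := by positivity
    have h1 := hpert n (ε / (q + 1)) (by linarith [hα n])
    have h2 : ε ≤ ε / (q + 1) * q := by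
      refine le_of_mul_le_mul_left ?_ ht
      rw [← hε, ← hq] at h1
      linarith
    have h3 : ε / (q + 1) * (q + 1) = ε := by field_simp
    linarith
  have hslack : ∀ n, α n * ⟪v, z n⟫ = α n := by
    intro n
    rcases (hα n).eq_or_lt with h0 | h0
    · rw [← h0, zero_mul]
    · have hle : ⟪v, z n⟫ ≤ 1 := by
        by_contra! hlt
        set q := ‖z n‖ ^ 2 / 2 with hq
        have hq0 : 0 ≤ q := by positivity
        set ε := ⟪v, z n⟫ - 1 with hε
        have hε0 : 0 < ε := by linarith
        set t := min (α n) (ε / (q + 1)) with htdef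
        have ht : 0 < t := lt_min h0 (by positivity)
        have h1 := hpert n (-t) (by linarith [min_le_left (α n) (ε / (q + 1))])
        have h2 : ε ≤ t * q := by
          refine le_of_mul_le_mul_left ?_ ht
          rw [← hq, ← neg_sub, ← hε] at h1
          linarith
        have h3 : t * (q + 1) ≤ ε := by
          rw [← le_div_iff₀ (by positivity)]; exact min_le_right _ _
        linarith
      rw [le_antisymm hle (hfeas n), mul_one]
  refine ⟨hfeas, fun w hw => ?_⟩
  have hvv : ‖v‖ ^ 2 = ∑ n, α n := 
    (sum_eq_norm_sq_of_slackness hv hslack).symm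
  have hwv : ‖v‖ ^ 2 ≤ ⟪w, v⟫ := by
    rw [hvv]
    conv_rhs => rw [hv, inner_sum]
    refine Finset.sum_le_sum fun n _ => ?_
    rw [inner_smul_right]
    exact le_mul_of_one_le_right (hα n) (hw n)
  have := norm_sub_sq_real w v
  nlinarith [sq_nonneg ‖w - v‖]

/-- Complementary slackness and primal feasibility imply dual optimality. -/
theorem dual_le_of_slackness {α : ι → ℝ} {w : E} (hw : w = ∑ n, α n • z n)
    (hslack : ∀ n, α n * ⟪w, z n⟫ = α n) (hfeas : ∀ n, 1 ≤ ⟪w, z n⟫) {β : ι → ℝ}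
    (hβ : ∀ n, 0 ≤ β n) :
    ∑ n, β n - 1 / 2 * ‖∑ n, β n • z n‖ ^ 2 ≤ ∑ n, α n - 1 / 2 * ‖∑ n, α n • z n‖ ^ 2 := by
  rw [sum_eq_norm_sq_of_slackness hw hslack, ← hw]
  have h1 : ∑ n, β n ≤ ⟪w, ∑ n, β n • z n⟫ := by
    rw [inner_sum]
    refine Finset.sum_le_sum fun n _ => ?_
    rw [inner_smul_right]
    exact le_mul_of_one_le_right (hβ n) (hfeas n)
  have := norm_sub_sq_real w (∑ n, β n • z n)
  nlinarith [sq_nonneg ‖w - ∑ n, β n • z n‖]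

end HardMargin

/-! ### Labeled data as signed features, and assembly -/

section Translation

variable {X : Type*} {d N : ℕ} {φ : X → EuclideanSpace ℝ (Fin d)} {x : Fin N → X} {τ : X → ℝ}

/-- The feature vectors multiplied by their labels. -/
def signedFeature (φ : X → EuclideanSpace ℝ (Fin d)) (x : Fin N → X) (τ : X → ℝ) (n : Fin N) :
    EuclideanSpace ℝ (Fin d) :=
  τ (x n) • φ (x n)

theorem inner_signedFeature (w : EuclideanSpace ℝ (Fin d)) (n : Fin N) :
    ⟪w, signedFeature φ x τ n⟫ = τ (x n) * ⟪w, φ (x n)⟫ :=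
  inner_smul_right _ _ _

theorem expLoss_eq (w : EuclideanSpace ℝ (Fin d)) :
    expLoss φ x τ w = ∑ n, Real.exp (-⟪w, signedFeature φ x τ n⟫) := by
  simp only [expLoss, inner_signedFeature]

theorem svmFeasible_eq :
    svmFeasible φ x τ = {w | ∀ n, 1 ≤ ⟪w, signedFeature φ x τ n⟫} := by
  simp only [svmFeasible, inner_signedFeature]

theorem svmDualObjective_eq (α : Fin N → ℝ) :
    svmDualObjective φ x τ α =
      ∑ n, α n - 1 / 2 * ‖∑ n, α n • signedFeature φ x τ n‖ ^ 2 := by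
  rw [svmDualObjective, ← real_inner_self_eq_norm_sq, sum_inner]
  congr 2
  refine Finset.sum_congr rfl fun i _ => ?_
  rw [inner_sum]
  refine Finset.sum_congr rfl fun j _ => ?_
  simp only [signedFeature, inner_smul_right, real_inner_smul_left]
  ring

theorem hasGradientAt_expLoss (w : EuclideanSpace ℝ (Fin d)) :
    HasGradientAt (expLoss φ x τ)
      (-∑ n, Real.exp (-⟪w, signedFeature φ x τ n⟫) • signedFeature φ x τ n) w := by
  rw [hasGradientAt_iff_hasFDerivAt]
  have hterm : ∀ n, HasFDerivAt
      (fun v : EuclideanSpace ℝ (Fin d) => Real.exp (-⟪v, signedFeature φ x τ n⟫))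
      (Real.exp (-⟪w, signedFeature φ x τ n⟫) • -(innerSL ℝ (signedFeature φ x τ n))) w := by
    intro n
    have h : HasFDerivAt (fun v : EuclideanSpace ℝ (Fin d) => ⟪v, signedFeature φ x τ n⟫)
        (innerSL ℝ (signedFeature φ x τ n)) w := by
      have h' := (innerSL ℝ (signedFeature φ x τ n)).hasFDerivAt (x := w)
      exact h'.congr_of_eventuallyEq
        (Eventually.of_forall fun v => by simp [real_inner_comm])
    exact h.fun_neg.exp
  have hsum := HasFDerivAt.fun_sum (u := Finset.univ) fun n _ => hterm n
  rw [show expLoss φ x τ = fun v => ∑ n, Real.exp (-⟪v, signedFeature φ x τ n⟫) from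
    funext expLoss_eq]
  have hdual : InnerProductSpace.toDual ℝ (EuclideanSpace ℝ (Fin d))
      (-∑ n, Real.exp (-⟪w, signedFeature φ x τ n⟫) • signedFeature φ x τ n) =
      ∑ n, Real.exp (-⟪w, signedFeature φ x τ n⟫) • -(innerSL ℝ (signedFeature φ x τ n)) := by
    refine ContinuousLinearMap.ext fun v => ?_
    rw [InnerProductSpace.toDual_apply_apply, inner_neg_left, sum_inner,
      _root_.sum_apply, ← Finset.sum_neg_distrib]
    refine Finset.sum_congr rfl fun n _ => ?_
    rw [real_inner_smul_left, ← mul_neg]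
    rfl
  rw [hdual]
  exact hsum

theorem gdIterate_succ (η : ℝ) (w₀ : EuclideanSpace ℝ (Fin d)) (m : ℕ) :
    gdIterate φ x τ η w₀ (m + 1) = gdIterate φ x τ η w₀ m + η • ∑ n,
      Real.exp (-⟪gdIterate φ x τ η w₀ m, signedFeature φ x τ n⟫) • signedFeature φ x τ n := by
  rw [gdIterate, Function.iterate_succ_apply', gdStep, (hasGradientAt_expLoss _).gradient,
    smul_neg, sub_neg_eq_add]
  rfl

theorem isHardMarginSVM_iff_eq_wSVM (hsep : LinearlySeparable φ x τ)
    (w : EuclideanSpace ℝ (Fin d)) : IsHardMarginSVM φ x τ w ↔ w = wSVM φ x τ := by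
  have hne : (svmFeasible φ x τ).Nonempty := by
    obtain ⟨v, hv⟩ := hsep
    obtain ⟨ε, hε, hεv⟩ : ∃ ε : ℝ, 0 < ε ∧ ∀ n, ε ≤ τ (x n) * ⟪v, φ (x n)⟫ := by
      rcases isEmpty_or_nonempty (Fin N) with h | h
      · exact ⟨1, one_pos, fun n => h.elim n⟩
      · obtain ⟨k, hk⟩ := Finite.exists_min fun n => τ (x n) * ⟪v, φ (x n)⟫
        exact ⟨_, hv k, hk⟩
    refine ⟨ε⁻¹ • v, fun n => ?_⟩
    rw [real_inner_smul_left, mul_left_comm, ← div_eq_inv_mul, one_le_div hε]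
    exact hεv n
  have huniq : ∃! w, IsHardMarginSVM φ x τ w :=
    existsUnique_isMinOn_norm_sq hne (svmFeasible_eq (φ := φ) ▸ isClosed_setOf_one_le_inner)
      (svmFeasible_eq (φ := φ) ▸ convex_setOf_one_le_inner)
  have hspec : IsHardMarginSVM φ x τ (wSVM φ x τ) := Classical.epsilon_spec huniq.exists
  exact ⟨fun h => huniq.unique h hspec, fun h => h ▸ hspec⟩

/-- Separability forces every label to be nonzero, so multiplying by labels does not change spans.
-/
theorem mem_span_signedFeature (hsep : LinearlySeparable φ x τ) {S : Set (Fin N)}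
    (hspan : Submodule.span ℝ ((fun n => φ (x n)) '' S) =
      Submodule.span ℝ (Set.range fun n => φ (x n))) (n : Fin N) :
    signedFeature φ x τ n ∈ Submodule.span ℝ (signedFeature φ x τ '' S) := by
  obtain ⟨v, hv⟩ := hsep
  refine Submodule.smul_mem _ _ ?_
  have hle : Submodule.span ℝ ((fun n => φ (x n)) '' S) ≤
      Submodule.span ℝ (signedFeature φ x τ '' S) := by
    rw [Submodule.span_le]
    rintro _ ⟨k, hk, rfl⟩
    have hτ : τ (x k) ≠ 0 := left_ne_zero_of_mul (hv k).ne'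
    have : φ (x k) = (τ (x k))⁻¹ • signedFeature φ x τ k := by
      rw [signedFeature, inv_smul_smul₀ hτ]
    change φ (x k) ∈ _
    rw [this]
    exact Submodule.smul_mem _ _ (Submodule.subset_span ⟨k, hk, rfl⟩)
  exact hle (hspan ▸ Submodule.subset_span ⟨n, rfl⟩)

/-- The vector `θ` itself separates: oddness gives `σ t * t > 0` for all `t ≠ 0`. -/
theorem linearlySeparable_taskEncoder {σ : ℝ → ℝ} (hσ_odd : Function.Odd σ)
    {θ : EuclideanSpace ℝ (Fin d)}
    (hσ : ∀ t, 0 < t → 0 < σ t) (hθ : ∀ n, ⟪θ, φ (x n)⟫ ≠ 0) : LinearlySeparable φ x (taskEncoder σ φ θ) := by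
  refine ⟨θ, fun n => ?_⟩
  rw [taskEncoder]
  rcases (hθ n).lt_or_gt with h | h
  · have h1 := hσ _ (neg_pos.2 h)
    rw [hσ_odd] at h1
    exact mul_pos_of_neg_of_neg (neg_pos.1 h1) h
  · exact mul_pos (hσ _ h) h

/-- Gradient descent on the exponential loss of a non-degenerate separable dataset: the implicit
bias towards the hard-margin solution and the resulting lower bound on the loss. -/
theorem gdIterate_asymptotics (hz : ∀ n, ‖signedFeature φ x τ n‖ ≤ 1)
    (hsep : LinearlySeparable φ x τ) (hnd : NonDegenerate φ x τ)
    (w₀ : EuclideanSpace ℝ (Fin d)) {η : ℝ} (hη : 0 < η) (hη1 : η * expLoss φ x τ w₀ < 1) :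
    ∃ (α : Fin N → ℝ) (wt : EuclideanSpace ℝ (Fin d)) (r : ℕ → EuclideanSpace ℝ (Fin d)),
      IsDualSVM φ x τ α ∧
      (∀ n ∈ supportIdx φ x τ, η * Real.exp (-(τ (x n) * ⟪wt, φ (x n)⟫)) = α n) ∧
      (∀ M : ℕ, 1 ≤ M →
        gdIterate φ x τ η w₀ M = Real.log M • wSVM φ x τ + wt + r M) ∧
      (∃ C : ℝ, ∀ M, ‖r M‖ ≤ C) ∧
      Tendsto (fun M => ‖r M‖) atTop (𝓝 0) ∧
      ∀ M : ℕ, 1 ≤ M →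
        ((M : ℝ) * η * Real.exp ‖r M‖)⁻¹ * ‖wSVM φ x τ‖ ^ 2 ≤
          expLoss φ x τ (gdIterate φ x τ η w₀ M) := by
  classical
  set z := signedFeature φ x τ
  set wh := wSVM φ x τ
  obtain ⟨hspan, β, ⟨hβ0, hβmax⟩, hβpos, hβzero⟩ := hnd
  let T : Finset (Fin N) := Finset.univ.filter (· ∈ supportIdx φ x τ)
  have hTS : ∀ n, n ∈ T ↔ n ∈ supportIdx φ x τ := fun n => by simp [T]
  have hTcoe : (T : Set (Fin N)) = supportIdx φ x τ := Set.ext hTS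
  have hwhfeas : ∀ n, 1 ≤ ⟪wh, z n⟫ := by
    have := ((isHardMarginSVM_iff_eq_wSVM hsep wh).2 rfl).1
    rwa [svmFeasible_eq] at this
  have hT : ∀ n ∈ T, ⟪wh, z n⟫ = 1 := fun n hn => by
    rw [inner_signedFeature]; exact (hTS n).1 hn
  have hTc : ∀ n ∉ T, 1 < ⟪wh, z n⟫ := fun n hn => by
    refine lt_of_le_of_ne (hwhfeas n) fun h => hn ((hTS n).2 ?_)
    rw [inner_signedFeature] at h
    exact h.symm
  have hzV : ∀ n, z n ∈ Submodule.span ℝ (z '' (T : Set (Fin N))) := fun n => by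
    rw [hTcoe]; exact mem_span_signedFeature hsep hspan n
  have hwhβ : ∑ n, β n • z n = wh := by
    have hprimal := primal_of_dual (z := z) hβ0 fun γ hγ => by
      have h : svmDualObjective φ x τ γ ≤ svmDualObjective φ x τ β := hβmax hγ
      rwa [svmDualObjective_eq, svmDualObjective_eq] at h
    refine (isHardMarginSVM_iff_eq_wSVM hsep _).1 ?_
    rw [IsHardMarginSVM, svmFeasible_eq]
    exact ⟨hprimal.1, fun w hw => hprimal.2 w hw⟩
  have hwhT : ∑ n ∈ T, β n • z n = wh := by
    rw [← hwhβ]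
    refine Finset.sum_subset (Finset.subset_univ T) fun n _ hn => ?_
    rw [hβzero n fun h => hn ((hTS n).2 h), zero_smul]
  obtain ⟨v, hvV, hv⟩ := exists_sum_exp_smul_eq (z := z)
    (fun n (hn : n ∈ T) => hβpos n ((hTS n).1 hn)) hη w₀
  obtain ⟨wt, hwt⟩ : ∃ y, y = w₀ + v := ⟨_, rfl⟩
  rw [← hwt] at hv
  -- Generally different from `β`, but it represents the same `wh` with the same support.
  let α : Fin N → ℝ := fun n => if n ∈ T then η * Real.exp (-⟪wt, z n⟫) else 0
  have hαT : ∀ n ∈ T, η * Real.exp (-⟪wt, z n⟫) = α n := fun n hn => (if_pos hn).symm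
  have hαTc : ∀ n ∉ T, α n = 0 := fun n hn => if_neg hn
  have hαpos : ∀ n ∈ T, 0 < α n := fun n hn => by rw [← hαT n hn]; positivity
  have hα0 : ∀ n, 0 ≤ α n := fun n => by
    by_cases hn : n ∈ T
    · exact (hαpos n hn).le
    · exact (hαTc n hn).ge
  have hwhα : wh = ∑ n ∈ T, α n • z n := by
    rw [← hwhT, ← hv]
    exact Finset.sum_congr rfl fun n hn => by rw [hαT n hn]
  have hwhα' : wh = ∑ n, α n • z n := by
    rw [hwhα]
    refine Finset.sum_subset (Finset.subset_univ T) fun n _ hn => ?_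
    rw [hαTc n hn, zero_smul]
  have hslack : ∀ n, α n * ⟪wh, z n⟫ = α n := fun n => by
    by_cases hn : n ∈ T
    · rw [hT n hn, mul_one]
    · rw [hαTc n hn, zero_mul]
  set w := gdIterate φ x τ η w₀ with hw
  have hw0 : w 0 = w₀ := rfl
  have hlim := tendsto_gd_residual hαpos hwhα hT hTc hzV hη hαT (gdIterate_succ η w₀)
    (by
      rw [← hw, hw0, hwt, sub_add_cancel_left]
      exact Submodule.neg_mem _ hvV)
    (summable_norm_sq_gd_step hz hη (gdIterate_succ η w₀) (by
      rw [expLoss_eq] at hη1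
      exact hη1))
  refine ⟨α, wt, fun M => w M - Real.log M • wh - wt, ⟨hα0, fun γ hγ => ?_⟩, fun n hn => ?_,
    fun M _ => by dsimp only; rw [sub_sub, add_sub_cancel], ?_, hlim, fun M hM => ?_⟩
  · change svmDualObjective φ x τ γ ≤ svmDualObjective φ x τ α
    rw [svmDualObjective_eq, svmDualObjective_eq]
    exact dual_le_of_slackness hwhα' hslack hwhfeas hγ
  · rw [← inner_signedFeature]
    exact hαT n ((hTS n).2 hn)
  · obtain ⟨C, hC⟩ := hlim.bddAbove_range
    exact ⟨C, fun M => hC ⟨M, rfl⟩⟩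
  · have hM0 : (0 : ℝ) < M := by exact_mod_cast hM
    set r := w M - Real.log M • wh - wt with hr
    have hwM : w M = r + Real.log M • wh + wt := by rw [hr]; abel
    rw [← sum_eq_norm_sq_of_slackness hwhα' hslack, expLoss_eq, Finset.mul_sum]
    refine Finset.sum_le_sum fun n _ => ?_
    by_cases hn : n ∈ T
    · have hrz : ⟪r, z n⟫ ≤ ‖r‖ := (real_inner_le_norm _ _).trans
        (mul_le_of_le_one_right (norm_nonneg _) (hz n))
      rw [← hαT n hn]
      calc ((M : ℝ) * η * Real.exp ‖r‖)⁻¹ * (η * Real.exp (-⟪wt, z n⟫))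
          = Real.exp (-‖r‖) * (M : ℝ)⁻¹ * Real.exp (-⟪wt, z n⟫) := by
            rw [Real.exp_neg ‖r‖]
            field_simp
        _ ≤ Real.exp (-⟪r, z n⟫) * (M : ℝ)⁻¹ * Real.exp (-⟪wt, z n⟫) := by gcongr
        _ = Real.exp (-⟪w M, z n⟫) := by
            rw [hwM, inner_add_left, inner_add_left, real_inner_smul_left, hT n hn, mul_one,
              neg_add, neg_add, Real.exp_add, Real.exp_add, Real.exp_neg (Real.log M),
              Real.exp_log hM0]
    · rw [hαTc n hn, mul_zero]
      exact (Real.exp_pos _).le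

end Translation

end GenObjective

theorem proposition3p1 {X : Type*} {d N : ℕ}
    (φ : X → EuclideanSpace ℝ (Fin d)) (x : Fin N → X) (hφ : ∀ n, ‖φ (x n)‖ ≤ 1)
    (σ : ℝ → ℝ) (hσ_odd : Function.Odd σ) (hσ_range : ∀ t, σ t ∈ Set.Icc (-1 : ℝ) 1)
    (θ : EuclideanSpace ℝ (Fin d)) (hθ : θ ≠ 0) :
    -- a sign-preserving activation produces linearly separable labelings
    ((∀ t, 0 < t → 0 < σ t) → (∀ n, inner ℝ θ (φ (x n)) ≠ 0) →
      GenObjective.LinearlySeparable φ x (GenObjective.taskEncoder σ φ θ)) ∧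
    (GenObjective.LinearlySeparable φ x (GenObjective.taskEncoder σ φ θ) →
      -- `wSVM` is the unique solution of the hard-margin SVM for the labeling
      (∀ w, GenObjective.IsHardMarginSVM φ x (GenObjective.taskEncoder σ φ θ) w ↔
        w = GenObjective.wSVM φ x (GenObjective.taskEncoder σ φ θ)) ∧
      (GenObjective.NonDegenerate φ x (GenObjective.taskEncoder σ φ θ) →
        ∀ (w₀ : EuclideanSpace ℝ (Fin d)) (η : ℝ), 0 < η →
          η < 1 / GenObjective.expLoss φ x (GenObjective.taskEncoder σ φ θ) w₀ →
          ∃ (α : Fin N → ℝ) (wt : EuclideanSpace ℝ (Fin d))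
            (r : ℕ → EuclideanSpace ℝ (Fin d)),
            GenObjective.IsDualSVM φ x (GenObjective.taskEncoder σ φ θ) α ∧
            (∀ n ∈ GenObjective.supportIdx φ x (GenObjective.taskEncoder σ φ θ),
              η * Real.exp (-(GenObjective.taskEncoder σ φ θ (x n) * inner ℝ wt (φ (x n)))) =
                α n) ∧
            -- `r M` is the residual of the gradient descent iterate `w_M`
            (∀ M : ℕ, 1 ≤ M →
              GenObjective.gdIterate φ x (GenObjective.taskEncoder σ φ θ) η w₀ M =
                Real.log M • GenObjective.wSVM φ x (GenObjective.taskEncoder σ φ θ) + wt + r M) ∧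
            (∃ C : ℝ, ∀ M, ‖r M‖ ≤ C) ∧
            Filter.Tendsto (fun M => ‖r M‖) Filter.atTop (nhds 0) ∧
            ∀ M : ℕ, 1 ≤ M →
              ((M : ℝ) * η * Real.exp ‖r M‖)⁻¹ *
                  ‖GenObjective.wSVM φ x (GenObjective.taskEncoder σ φ θ)‖ ^ 2 ≤
                GenObjective.binaryObjective φ x σ η w₀ M θ)) := by
  refine ⟨GenObjective.linearlySeparable_taskEncoder hσ_odd, fun hsep =>
    ⟨GenObjective.isHardMarginSVM_iff_eq_wSVM hsep, fun hnd w₀ η hη hη1 => ?_⟩⟩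
  refine GenObjective.gdIterate_asymptotics (fun n => ?_) hsep hnd w₀ hη ?_
  · rw [GenObjective.signedFeature, norm_smul]
    exact mul_le_one₀ (abs_le.2 (hσ_range _)) (norm_nonneg _) (hφ n)
  · have hL : 0 < GenObjective.expLoss φ x (GenObjective.taskEncoder σ φ θ) w₀ :=
      one_div_pos.1 (hη.trans hη1)
    exact (lt_div_iff₀ hL).1 hη1
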